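/- Let $p$ be a prime, $\mathbb F=\mathbb F_p$ and $e(t)=e^{2\pi i t/p}$ for $t\in\mathbb F$. For $f:\mathbb F^N\to\mathbb F$ put $f_y(x)=f(x+y)-f(x)$, $f_{y_1\dots y_d}=(f_{y_1\dots y_{d-1}})_{y_d}$, and let $\|f\|_{U^d}=\left(\mathbb E_{x,y_1,\dots,y_d\in\mathbb F^N}\, e(f_{y_1\dots y_d}(x))\right)^{1/2^d}$ be the $d$-th Gowers norm. For $f,g:\mathbb F^N\to\mathbb F$ let $\langle f,g\rangle=\mathbb E_{x\in\mathbb F^N}\, e(f(x)-g(x))$. Let $S_n(x)=\sum_{I\subseteq\{1,\dots,N\},\,|I|=n}\prod_{i\in I}x_i$ be the elementary symmetric polynomial of degree $n$ in $N$ variables, viewed as a function $\mathbb F^N\to\mathbb F$. Then for every prime $p$ and every integer $k\ge 2$ (in particular for $k=2$, that is, for $S_{p^2}$): 1. There is $\varepsilon>0$, independent of $N$ (it may depend on $p$ and $k$), such that $\|S_{p^k}\|_{U^{p^k}}>\varepsilon$ for all $N$. 2. $S_{p^k}$ has only $o(1)$ correlation with polynomials of degree below $p^k$: for every $\delta>0$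 there is $N_0$ such that for all $N\ge N_0$ and every polynomial $g\in\mathbb F[x_1,\dots,x_N]$ of degree less than $p^k$ one has $|\langle S_{p^k},g\rangle|<\delta$. 3. Consequently the inverse conjecture for the Gowers norm over $\mathbb F_p$ fails for $d=p^k$ (in particular for $d=p^2$). This conjecture asserts: for every $\varepsilon>0$ there is $\delta>0$ such that for all sufficiently large $N$ and every $f:\mathbb F^N\to\mathbb F$ with $\|f\|_{U^d}>\varepsilon$ there is a polynomial $g\in\mathbb F[x_1,\dots,x_N]$ of degree less than $d$ with $|\langle f,g\rangle|>\delta$. -/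

import Mathlib

open scoped BigOperators

noncomputable section

namespace GowersInverse

/-- The iterated derivative `f_{y_1 ... y_k}`, where `f_y(x) = f(x + y) - f(x)` and
`f_{y_1 ... y_k} = (f_{y_1 ... y_{k-1}})_{y_k}`. -/
def iterDeriv {V F : Type*} [AddCommGroup V] [AddCommGroup F] (f : V → F) :
    (k : ℕ) → (Fin k → V) → V → F
  | 0, _ => f
  | k + 1, y => fwdDiff (y (Fin.last k)) (iterDeriv f k (Fin.init y))

variable {p : ℕ} [NeZero p] {N : ℕ}

/-- The average `𝔼_{x, y_1, ..., y_k} e(f_{y_1 ... y_k}(x))`, with `e(t) = exp(2πi t / p)`. -/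
def gowersAverage (k : ℕ) (f : (Fin N → ZMod p) → ZMod p) : ℂ :=
  𝔼 y : Fin k → (Fin N → ZMod p), 𝔼 x : Fin N → ZMod p,
    ZMod.stdAddChar (iterDeriv f k y x)

/-- The Gowers norm `‖f‖_{U^k}`, the `2^k`-th root of the Gowers average. For `k ≥ 1` the average
is a nonnegative real number, so it equals its modulus (see `gowersNorm_pow`). -/
def gowersNorm (k : ℕ) (f : (Fin N → ZMod p) → ZMod p) : ℝ :=
  ‖gowersAverage k f‖ ^ (1 / (2 : ℝ) ^ k)

/-- The correlation `⟨f, g⟩ = 𝔼_x e(f(x) - g(x))`. -/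
def correlation (f g : (Fin N → ZMod p) → ZMod p) : ℂ :=
  𝔼 x : Fin N → ZMod p, ZMod.stdAddChar (f x - g x)

/-- The function on `𝔽_p^N` given by the elementary symmetric polynomial `S_n` in `N` variables. -/
def symFun (p N n : ℕ) (x : Fin N → ZMod p) : ZMod p :=
  MvPolynomial.eval x (MvPolynomial.esymm (Fin N) (ZMod p) n)

/-- The inverse conjecture for the `d`-th Gowers norm over `𝔽_p`: for every `ε > 0` there is
`δ > 0` such that for all sufficiently large `N`, every `f : 𝔽_p^N → 𝔽_p` with `‖f‖_{U^d} > ε`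
satisfies `|⟨f, g⟩| > δ` for some polynomial `g` of degree less than `d`. -/
def InverseConjecture (p : ℕ) [NeZero p] (d : ℕ) : Prop :=
  ∀ ε : ℝ, 0 < ε → ∃ δ : ℝ, 0 < δ ∧ ∃ N₀ : ℕ, ∀ N : ℕ, N₀ ≤ N →
    ∀ f : (Fin N → ZMod p) → ZMod p, ε < gowersNorm d f →
      ∃ g : MvPolynomial (Fin N) (ZMod p), g.totalDegree < d ∧
        δ < ‖correlation f (fun x => MvPolynomial.eval x g)‖

theorem gowersAverage_succ (k : ℕ) (f : (Fin N → ZMod p) → ZMod p) :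
    gowersAverage (k + 1) f =
      ((𝔼 y : Fin k → (Fin N → ZMod p),
        ‖𝔼 x : Fin N → ZMod p, (ZMod.stdAddChar (iterDeriv f k y x) : ℂ)‖ ^ 2 : ℝ) : ℂ) := by
  have key : ∀ g : (Fin N → ZMod p) → ZMod p,
      (𝔼 h : Fin N → ZMod p, 𝔼 x : Fin N → ZMod p, (ZMod.stdAddChar (fwdDiff h g x) : ℂ)) =
        ((‖𝔼 x : Fin N → ZMod p, (ZMod.stdAddChar (g x) : ℂ)‖ ^ 2 : ℝ) : ℂ) := by
    intro g
    rw [Finset.expect_comm]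
    have h1 : ∀ x : Fin N → ZMod p,
        (𝔼 h : Fin N → ZMod p, (ZMod.stdAddChar (fwdDiff h g x) : ℂ)) =
          (𝔼 h : Fin N → ZMod p, (ZMod.stdAddChar (g h) : ℂ)) *
            (starRingEnd ℂ) (ZMod.stdAddChar (g x)) := by
      intro x
      rw [Finset.expect_mul]
      refine Fintype.expect_equiv (Equiv.addLeft x) _ _ fun h => ?_
      simp only [fwdDiff, Equiv.coe_addLeft]
      rw [sub_eq_add_neg, AddChar.map_add_eq_mul, AddChar.map_neg_eq_conj]
    simp_rw [h1]
    rw [← Finset.mul_expect, ← map_expect (starRingEnd ℂ), Complex.mul_conj, Complex.normSq_eq_norm_sq]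
  have h2 : gowersAverage (k + 1) f =
      𝔼 y : Fin k → (Fin N → ZMod p), 𝔼 h : Fin N → ZMod p, 𝔼 x : Fin N → ZMod p,
        (ZMod.stdAddChar (fwdDiff h (iterDeriv f k y) x) : ℂ) := by
    symm
    rw [gowersAverage, Finset.expect_comm, ← Finset.expect_product',
      Finset.univ_product_univ]
    exact Fintype.expect_equiv (M := ℂ)
      (Fin.snocEquiv fun _ : Fin (k + 1) => Fin N → ZMod p) _ _ fun q => by
        simp [iterDeriv, Fin.snocEquiv]
  rw [h2]
  simp_rw [key]
  push_cast
  rfl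

theorem gowersNorm_pow (k : ℕ) (f : (Fin N → ZMod p) → ZMod p) :
    (gowersNorm (k + 1) f : ℂ) ^ 2 ^ (k + 1) = gowersAverage (k + 1) f := by
  have h : (gowersNorm (k + 1) f) ^ 2 ^ (k + 1) = ‖gowersAverage (k + 1) f‖ := by
    rw [gowersNorm, ← Real.rpow_natCast, ← Real.rpow_mul (norm_nonneg _)]
    simp
  rw [← Complex.ofReal_pow, h, gowersAverage_succ, Complex.norm_of_nonneg]
  exact Finset.expect_nonneg fun _ _ => sq_nonneg _

end GowersInverse

end

open scoped BigOperators

noncomputable section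

namespace GowersInverse

/-! Write n = p^k, m = n - 1. Large norm: the Gowers average is the mean over y_1, ..., y_m of the
squared modulus of a mean over x. Polarizing S_n gives a sum over tuples of distinct indices. If the
product of every nonempty subfamily of the y_j has zero coordinate sum, this collapses to ±m! ∑_i
y_{1,i} ⋯ y_{m,i} x_i (`polar_eq_factorial_mul`), which is 0 because p ≤ m when k ≥ 2. The m-fold
derivative is then constant and the inner mean has modulus 1. Such families have density at least
p^(-2^m), whatever N is (`pow_le_mul_card_isNull`). Small correlation: average over the cubes a +
{0,1}^N. There S_n - g is multilinear, with coefficient 1 in degree n, 0 above n, and arbitrary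
below. Ramsey's theorem, applied degree by degree, passes to subcubes where all coefficients depend
only on degree (`CubeSumsSmall.succ`). The function then depends on the weight alone, and adding n
to the weight adds 1 to its value, because n is a power of p. This forces cancellation
(`cubeSumsSmall_zero`). The bounds depend neither on g nor on a. -/

/-! ### Ramsey's theorem for colourings of finite sets -/

/-- Ramsey's theorem for colourings of the `j`-element subsets of a finite set. -/
theorem exists_monochromatic (κ : Type) [Fintype κ] [Nonempty κ] (j m : ℕ) :
    ∃ R : ℕ, ∀ (α : Type) [DecidableEq α] (U : Finset α), R ≤ U.card → ∀ χ : Finset α → κ,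
      ∃ W ⊆ U, W.card = m ∧ ∃ c, ∀ A ⊆ W, A.card = j → χ A = c := by
  classical
  induction j generalizing m with
  | zero =>
    refine ⟨m, fun α _ U hU χ => ?_⟩
    obtain ⟨W, hW, hc⟩ := Finset.exists_subset_card_eq hU
    refine ⟨W, hW, hc, χ ∅, fun A _ hA => ?_⟩
    rw [Finset.card_eq_zero.1 hA]
  | succ j ih =>
    -- first pass to a set on which the colour of `A` is determined by one of its elements
    have key : ∀ t : ℕ, ∃ R : ℕ, ∀ (α : Type) [DecidableEq α] (U : Finset α), R ≤ U.card →
        ∀ χ : Finset α → κ, ∃ V ⊆ U, V.card = t ∧ ∃ γ : α → κ, ∀ A ⊆ V, A.card = j + 1 →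
          ∃ a ∈ A, χ A = γ a := by
      intro t
      induction t with
      | zero =>
        refine ⟨0, fun α _ U _ χ => ⟨∅, by simp, by simp, fun _ => Classical.arbitrary κ, ?_⟩⟩
        intro A hA hc
        rw [Finset.subset_empty.1 hA] at hc
        simp at hc
      | succ t iht =>
        obtain ⟨R₁, hR₁⟩ := iht
        obtain ⟨R₂, hR₂⟩ := ih R₁
        refine ⟨R₂ + 1, fun α _ U hU χ => ?_⟩
        obtain ⟨a, ha⟩ : U.Nonempty := Finset.card_pos.1 (by omega)
        -- Colouring B by the colour of `insert a B` makes all (j+1)-sets formed by a and j points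
        -- of W share the colour c, which becomes γ a.
        obtain ⟨W, hWU, hWc, c, hc⟩ := hR₂ α (U.erase a)
          (by rw [Finset.card_erase_of_mem ha]; omega) (fun B => χ (insert a B))
        obtain ⟨V, hVW, hVc, γ, hγ⟩ := hR₁ α W hWc.ge χ
        have haV : a ∉ V := fun h => by simpa using hWU (hVW h)
        refine ⟨insert a V, ?_, by rw [Finset.card_insert_of_notMem haV, hVc],
          Function.update γ a c, fun A hA hAc => ?_⟩
        · exact Finset.insert_subset ha
            ((hVW.trans hWU).trans (Finset.erase_subset _ _))
        · by_cases haA : a ∈ A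
          · refine ⟨a, haA, ?_⟩
            have h := hc (A.erase a) (Finset.subset_insert_iff.1 hA |>.trans hVW)
              (by rw [Finset.card_erase_of_mem haA]; omega)
            simpa [Finset.insert_erase haA] using h
          · have hAV : A ⊆ V := (Finset.subset_insert_iff_of_notMem haA).1 hA
            obtain ⟨b, hb, hχ⟩ := hγ A hAV hAc
            have hne : b ≠ a := fun h => haA (h ▸ hb)
            exact ⟨b, hb, by rw [hχ, Function.update_of_ne hne]⟩
    obtain ⟨R, hR⟩ := key (Fintype.card κ * m)
    refine ⟨R, fun α _ U hU χ => ?_⟩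
    obtain ⟨V, hVU, hVc, γ, hγ⟩ := hR α U hU χ
    -- Pigeonhole for γ: on a fibre, the element deciding the colour of A no longer matters.
    obtain ⟨c, -, hc⟩ := Finset.exists_le_card_fiber_of_mul_le_card_of_maps_to
      (s := V) (t := (Finset.univ : Finset κ)) (f := γ) (n := m) (by simp) (by simp)
      (by rw [hVc, Finset.card_univ])
    obtain ⟨W, hW, hWc⟩ := Finset.exists_subset_card_eq hc
    refine ⟨W, (hW.trans (Finset.filter_subset _ _)).trans hVU, hWc, c, fun A hA hAc => ?_⟩
    obtain ⟨a, ha, hχ⟩ := hγ A (hA.trans (hW.trans (Finset.filter_subset _ _))) hAc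
    rw [hχ]
    exact (Finset.mem_filter.1 (hW (hA ha))).2

/-! ### Splitting a cube -/

theorem sum_powerset_eq_sum_sum {α M : Type*} [DecidableEq α] [AddCommMonoid M] {U W : Finset α}
    (hW : W ⊆ U) (F : Finset α → M) :
    ∑ X ∈ U.powerset, F X = ∑ Y ∈ (U \ W).powerset, ∑ Z ∈ W.powerset, F (Z ∪ Y) := by
  rw [Finset.sum_sigma']
  refine Finset.sum_nbij' (fun X => ⟨X \ W, X ∩ W⟩) (fun q => q.2 ∪ q.1) ?_ ?_ ?_ ?_ ?_
  · intro X hX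
    simp only [Finset.mem_sigma, Finset.mem_powerset] at hX ⊢
    exact ⟨Finset.sdiff_subset_sdiff hX subset_rfl, Finset.inter_subset_right⟩
  · rintro ⟨Y, Z⟩ h
    simp only [Finset.mem_sigma, Finset.mem_powerset] at h ⊢
    exact Finset.union_subset (h.2.trans hW) (h.1.trans Finset.sdiff_subset)
  · intro X _
    ext x
    simp
    tauto
  · rintro ⟨Y, Z⟩ h
    simp only [Finset.mem_sigma, Finset.mem_powerset] at h
    have h1 : ∀ x ∈ Y, x ∉ W := fun x hx => (Finset.mem_sdiff.1 (h.1 hx)).2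
    have h2 : ∀ x ∈ Z, x ∈ W := fun x hx => h.2 hx
    have e1 : (Z ∪ Y) \ W = Y := by
      ext x; simp only [Finset.mem_sdiff, Finset.mem_union]; grind
    have e2 : (Z ∪ Y) ∩ W = Z := by
      ext x; simp only [Finset.mem_inter, Finset.mem_union]; grind
    simp [e1, e2]
  · intro X _
    congr 1
    ext x
    simp
    tauto

/-- Sums over `U` are controlled by those over the subcubes parallel to `W`. -/
theorem norm_sum_powerset_le {α : Type*} [DecidableEq α] {U W : Finset α} (hW : W ⊆ U)
    (F : Finset α → ℂ) (K : ℝ)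
    (hF : ∀ Y ⊆ U \ W, ‖∑ Z ∈ W.powerset, F (Z ∪ Y)‖ ≤ K * 2 ^ W.card) :
    ‖∑ X ∈ U.powerset, F X‖ ≤ K * 2 ^ U.card := by
  rw [sum_powerset_eq_sum_sum hW]
  calc _ ≤ ∑ Y ∈ (U \ W).powerset, K * 2 ^ W.card :=
        norm_sum_le_of_le _ fun Y hY => hF Y (Finset.mem_powerset.1 hY)
    _ = K * 2 ^ U.card := by
        rw [Finset.sum_const, Finset.card_powerset, nsmul_eq_mul,
          ← Finset.card_sdiff_add_card_eq_card hW, pow_add]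
        push_cast
        ring

/-! ### Symmetric functions on the cube -/

/-- Strict convexity: equality in the triangle inequality for vectors of equal norm forces them to
coincide. -/
theorem norm_one_add_lt_two {ζ : ℂ} (h : ‖ζ‖ = 1) (h1 : ζ ≠ 1) : ‖1 + ζ‖ < 2 := by
  have hle : ‖1 + ζ‖ ≤ 2 := by
    calc ‖1 + ζ‖ ≤ ‖(1 : ℂ)‖ + ‖ζ‖ := norm_add_le _ _
      _ = 2 := by rw [h, norm_one]; norm_num
  refine lt_of_le_of_ne hle fun h2 => h1 ?_
  have h3 : ‖(1 : ℂ) + ζ‖ = ‖(1 : ℂ)‖ + ‖ζ‖ := by rw [h2, h, norm_one]; norm_num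
  exact (eq_of_norm_eq_of_norm_add_eq (by rw [h, norm_one]) h3).symm

/-- A quasi-periodic function of the weight has exponentially small average over the cube. -/
theorem norm_sum_quasiperiodic_le {q : ℕ} (hq : 0 < q) {ζ : ℂ} (H : ℕ → ℂ)
    (hH1 : ∀ v, ‖H v‖ ≤ 1) (hH : ∀ v, H (v + q) = ζ * H v) {α : Type*} [DecidableEq α] (s : ℕ)
    (U : Finset α) (hU : q * s ≤ U.card) (v : ℕ) :
    ‖∑ X ∈ U.powerset, H (v + X.card)‖ ≤ ((2 ^ q - 2 + ‖1 + ζ‖) / 2 ^ q) ^ s * 2 ^ U.card := by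
  have h2q : (2 : ℝ) ≤ 2 ^ q := by
    calc (2 : ℝ) = 2 ^ 1 := by norm_num
      _ ≤ 2 ^ q := pow_le_pow_right₀ (by norm_num) hq
  induction s generalizing U v with
  | zero =>
    calc _ ≤ ∑ X ∈ U.powerset, (1 : ℝ) := norm_sum_le_of_le _ fun X _ => hH1 _
      _ = _ := by simp
  | succ s ih =>
    set ρ : ℝ := (2 ^ q - 2 + ‖1 + ζ‖) / 2 ^ q with hρ
    have hρ0 : 0 ≤ ρ := div_nonneg (by linarith [norm_nonneg (1 + ζ)]) (by positivity)
    obtain ⟨W, hWU, hWc⟩ := Finset.exists_subset_card_eq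
      (show q ≤ U.card from le_trans (by rw [mul_add, mul_one]; omega) hU)
    have hcard := Finset.card_sdiff_add_card_eq_card hWU
    -- The sum over the remaining coordinates is again quasi-periodic in the weight coming from W.
    set G : ℕ → ℂ := fun u => ∑ Y ∈ (U \ W).powerset, H (u + Y.card) with hG
    have hGb : ∀ u, ‖G u‖ ≤ ρ ^ s * 2 ^ (U \ W).card := fun u =>
      ih _ (by rw [mul_add, mul_one] at hU; omega) u
    have hGq : ∀ u, G (u + q) = ζ * G u := by
      intro u
      simp only [hG, Finset.mul_sum]
      exact Finset.sum_congr rfl fun Y _ => by rw [← hH]; congr 1; omega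
    have hsplit : ∑ X ∈ U.powerset, H (v + X.card) = ∑ Z ∈ W.powerset, G (v + Z.card) := by
      rw [sum_powerset_eq_sum_sum hWU, Finset.sum_comm]
      refine Finset.sum_congr rfl fun Z hZ => Finset.sum_congr rfl fun Y hY => ?_
      rw [Finset.card_union_of_disjoint, add_assoc]
      exact Finset.disjoint_of_subset_left (Finset.mem_powerset.1 hZ)
        (Finset.disjoint_of_subset_right (Finset.mem_powerset.1 hY) Finset.disjoint_sdiff)
    -- The terms Z = W and Z = ∅ differ by the factor ζ and combine to (1 + ζ) G v. The other 2^q -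
    -- 2 terms are bounded trivially, whence ρ.
    have hne : (∅ : Finset α) ∈ W.powerset.erase W := by
      rw [Finset.mem_erase]
      refine ⟨?_, Finset.empty_mem_powerset _⟩
      rintro rfl
      simp at hWc
      omega
    have hcount : (((W.powerset.erase W).erase ∅).card : ℝ) = 2 ^ q - 2 := by
      rw [Finset.card_erase_of_mem hne, Finset.card_erase_of_mem (Finset.mem_powerset_self W),
        Finset.card_powerset, hWc]
      have : 2 ≤ 2 ^ q := by exact_mod_cast h2q
      rw [Nat.sub_sub, Nat.cast_sub (by omega)]
      push_cast
      norm_num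
    rw [hsplit, ← Finset.add_sum_erase _ _ (Finset.mem_powerset_self W),
      ← Finset.add_sum_erase _ _ hne, ← add_assoc, hWc, hGq, Finset.card_empty, add_zero]
    set K : ℝ := ρ ^ s * 2 ^ (U \ W).card
    calc _ ≤ ‖ζ * G v + G v‖ + ‖∑ Z ∈ (W.powerset.erase W).erase ∅, G (v + Z.card)‖ :=
          norm_add_le _ _
      _ ≤ ‖1 + ζ‖ * K + (2 ^ q - 2) * K := by
          gcongr
          · rw [show ζ * G v + G v = (1 + ζ) * G v by ring, norm_mul]
            gcongr
            exact hGb v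
          · rw [← hcount, ← nsmul_eq_mul, ← Finset.sum_const]
            exact norm_sum_le_of_le _ fun Z _ => hGb _
      _ = ρ ^ (s + 1) * 2 ^ U.card := by
          have : ρ * 2 ^ q = 2 ^ q - 2 + ‖1 + ζ‖ := by
            rw [hρ]; field_simp
          rw [← hcard, hWc, pow_add, pow_succ]
          linear_combination (-K) * this

section CubeSums

variable {p : ℕ}

/-- Vandermonde: p divides C(p^k, b) for 0 < b < p^k, so only b = 0 and b = p^k can contribute. -/
theorem cast_choose_add_prime_pow [Fact p.Prime] (k v i : ℕ) (hi : i ≤ p ^ k) :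
    ((v + p ^ k).choose i : ZMod p) = v.choose i + if i = p ^ k then 1 else 0 := by
  have hp : p.Prime := Fact.out
  have hq : 0 < p ^ k := pow_pos hp.pos k
  rw [Nat.add_choose_eq]
  push_cast
  have hz : ∀ b, b ≠ 0 → b ≠ p ^ k → (((p ^ k).choose b : ℕ) : ZMod p) = 0 := by
    intro b h0 h1
    exact (ZMod.natCast_eq_zero_iff _ _).2 (hp.dvd_choose_pow h0 h1)
  have h0 : ((i, 0) : ℕ × ℕ) ∈ Finset.HasAntidiagonal.antidiagonal i := by simp
  rw [← Finset.add_sum_erase _ _ h0]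
  congr 1
  · simp
  split_ifs with h
  · subst h
    rw [Finset.sum_eq_single (0, p ^ k)]
    · simp
    · rintro ⟨a, b⟩ hab hne
      simp only [Finset.mem_erase, Finset.HasAntidiagonal.mem_antidiagonal, ne_eq, Prod.mk.injEq, not_and] at hab hne
      rw [hz b (by rintro rfl; omega) (by rintro rfl; omega), mul_zero]
    · intro h
      simp at h
      omega
  · refine Finset.sum_eq_zero ?_
    rintro ⟨a, b⟩ hab
    simp only [Finset.mem_erase, Finset.HasAntidiagonal.mem_antidiagonal, ne_eq, Prod.mk.injEq, not_and] at hab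
    rw [hz b (by rintro rfl; omega) (by omega), mul_zero]

/-- The coefficients `c` on subsets of `U` depend only on the cardinality from degree `j` on, are
equal to `1` in degree `n` and vanish in degrees above `n`. -/
def SymmetricFrom {α : Type*} (n j : ℕ) (U : Finset α) (c : Finset α → ZMod p) : Prop :=
  ∃ s : ℕ → ZMod p, s n = 1 ∧ (∀ i, n < i → s i = 0) ∧ ∀ A ⊆ U, j ≤ A.card → c A = s A.card

/-- All functions on a large cube with coefficients in the class `SymmetricFrom n j` are
almost equidistributed. -/
def CubeSumsSmall (p : ℕ) [NeZero p] (n j : ℕ) : Prop :=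
  ∀ δ : ℝ, 0 < δ → ∃ N₀ : ℕ, ∀ (α : Type) [DecidableEq α] (U : Finset α), N₀ ≤ U.card →
    ∀ c : Finset α → ZMod p, SymmetricFrom n j U c →
      ‖∑ X ∈ U.powerset, (ZMod.stdAddChar (∑ A ∈ X.powerset, c A) : ℂ)‖ ≤ δ * 2 ^ U.card

variable [Fact p.Prime]

/-- The value at X is ∑ C(|X|, i) s_i. Raising |X| by p^k adds s_{p^k} = 1, so its character is
quasi-periodic with multiplier ζ = e(1) ≠ 1. -/
theorem cubeSumsSmall_zero (k : ℕ) : CubeSumsSmall p (p ^ k) 0 := by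
  have hp : p.Prime := Fact.out
  have hq : 0 < p ^ k := pow_pos hp.pos k
  intro δ hδ
  set ζ : ℂ := ZMod.stdAddChar (1 : ZMod p) with hζ
  have hζn : ‖ζ‖ = 1 := AddChar.norm_apply _ _
  have hζ1 : ζ ≠ 1 := by
    intro h
    rw [hζ, ← AddChar.map_zero_eq_one (ZMod.stdAddChar (N := p))] at h
    exact one_ne_zero (ZMod.injective_stdAddChar h)
  have hlt := norm_one_add_lt_two hζn hζ1
  have h2q : (2 : ℝ) ≤ 2 ^ p ^ k := by
    calc (2 : ℝ) = 2 ^ 1 := by norm_num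
      _ ≤ 2 ^ p ^ k := pow_le_pow_right₀ (by norm_num) hq
  obtain ⟨s₀, hs₀⟩ := exists_pow_lt_of_lt_one hδ
    (show (2 ^ p ^ k - 2 + ‖1 + ζ‖) / 2 ^ p ^ k < 1 by
      rw [div_lt_one (by positivity)]; linarith)
  refine ⟨p ^ k * s₀, fun α _ U hU c ⟨s, hs1, hs0, hs⟩ => ?_⟩
  set H : ℕ → ℂ := fun v =>
    ZMod.stdAddChar (∑ i ∈ Finset.range (p ^ k + 1), (v.choose i : ZMod p) * s i) with hH
  have hHq : ∀ v, H (v + p ^ k) = ζ * H v := by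
    intro v
    simp only [hH, hζ]
    rw [← AddChar.map_add_eq_mul]
    congr 1
    rw [Finset.sum_congr rfl fun i hi => by
      rw [cast_choose_add_prime_pow k v i (by simpa [Nat.lt_succ_iff] using hi), add_mul]]
    rw [Finset.sum_add_distrib, add_comm]
    simp [hs1]
  have hval : ∀ X ∈ U.powerset,
      (ZMod.stdAddChar (∑ A ∈ X.powerset, c A) : ℂ) = H (0 + X.card) := by
    intro X hX
    rw [Finset.mem_powerset] at hX
    simp only [hH, zero_add]
    congr 1
    rw [Finset.sum_congr rfl fun A hA =>
      hs A ((Finset.mem_powerset.1 hA).trans hX) (Nat.zero_le _), Finset.sum_powerset_apply_card]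
    simp only [nsmul_eq_mul]
    -- Both sums are extended to a common range: beyond |X| the binomials vanish, beyond p^k the s_i
    -- do.
    refine (Finset.sum_subset (Finset.range_mono
      (show X.card + 1 ≤ X.card + p ^ k + 1 by omega)) fun i _ hi => ?_).trans
      (Finset.sum_subset (Finset.range_mono
        (show p ^ k + 1 ≤ X.card + p ^ k + 1 by omega)) fun i _ hi => ?_).symm
    · rw [Nat.choose_eq_zero_of_lt (by simpa using hi), Nat.cast_zero, zero_mul]
    · rw [hs0 i (by simpa using hi), mul_zero]
  rw [Finset.sum_congr rfl hval]
  refine (norm_sum_quasiperiodic_le hq H (fun v => (AddChar.norm_apply _ _).le) hHq s₀ U hU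
    0).trans ?_
  gcongr

/-- Ramsey gives W on which the degree-j coefficients are constant. On the subcube of sets Z ∪ Y
with Z ⊆ W, the coefficient at A is ∑_{B ⊆ Y} c (A ∪ B). For |A| ≥ j, only A itself with |A| = j can
meet degree j, and there c is the Ramsey colour. -/
theorem CubeSumsSmall.succ {n j : ℕ} (hj : j < n) (h : CubeSumsSmall p n j) :
    CubeSumsSmall p n (j + 1) := by
  intro δ hδ
  obtain ⟨m, hm⟩ := h δ hδ
  obtain ⟨R, hR⟩ := exists_monochromatic (ZMod p) j m
  refine ⟨R, fun α _ U hU c ⟨s, hs1, hs0, hs⟩ => ?_⟩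
  obtain ⟨W, hWU, hWc, a, ha⟩ := hR α U hU c
  refine norm_sum_powerset_le hWU _ δ fun Y hY => ?_
  have hdisj : Disjoint W Y :=
    Finset.disjoint_of_subset_right hY Finset.disjoint_sdiff
  have hYU : Y ⊆ U := hY.trans Finset.sdiff_subset
  have hsum : ∀ Z ∈ W.powerset, ∑ A ∈ (Z ∪ Y).powerset, c A =
      ∑ A ∈ Z.powerset, ∑ B ∈ Y.powerset, c (A ∪ B) := by
    intro Z hZ
    rw [Finset.mem_powerset] at hZ
    rw [sum_powerset_eq_sum_sum (Finset.subset_union_left : Z ⊆ Z ∪ Y), Finset.sum_comm]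
    have : (Z ∪ Y) \ Z = Y :=
      Finset.union_sdiff_cancel_left (Finset.disjoint_of_subset_left hZ hdisj)
    rw [this]
  rw [Finset.sum_congr rfl fun Z hZ => by rw [hsum Z hZ]]
  refine hm α W hWc.ge _ ?_
  -- The hypothesis says nothing about `s j`, so it is reset to the Ramsey colour; since j < n,
  -- degrees n and above are unaffected.
  set s' : ℕ → ZMod p := Function.update s j a with hs'
  refine ⟨fun i => ∑ B ∈ Y.powerset, s' (i + B.card), ?_, ?_, fun A hA hAj => ?_⟩
  · refine (Finset.sum_eq_single ∅ ?_ ?_).trans ?_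
    rotate_left 2
    · simp [hs', hj.ne', hs1]
    · intro B _ hB
      have := Finset.card_pos.2 (Finset.nonempty_iff_ne_empty.2 hB)
      rw [hs', Function.update_of_ne (by omega), hs0 _ (by omega)]
    · simp
  · intro i hi
    exact Finset.sum_eq_zero fun B _ => by
      rw [hs', Function.update_of_ne (by omega), hs0 _ (by omega)]
  · refine Finset.sum_congr rfl fun B hB => ?_
    rw [Finset.mem_powerset] at hB
    have hAB : Disjoint A B := Finset.disjoint_of_subset_left hA
      (Finset.disjoint_of_subset_right hB hdisj)
    have hc := Finset.card_union_of_disjoint hAB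
    by_cases hcase : A.card + B.card = j
    · have hB0 : B = ∅ := Finset.card_eq_zero.1 (by omega)
      subst hB0
      simp only [Finset.card_empty, add_zero] at hcase ⊢
      rw [Finset.union_empty, ha A hA hcase, hs', hcase, Function.update_self]
    · rw [hs', Function.update_of_ne hcase, ← hc]
      exact hs _ (Finset.union_subset (hA.trans hWU) (hB.trans hYU)) (by omega)

/-- At level p^k the coefficients of lower degree are arbitrary, which leaves room for any g. -/
theorem cubeSumsSmall (k : ℕ) : CubeSumsSmall p (p ^ k) (p ^ k) := by
  have : ∀ j, j ≤ p ^ k → CubeSumsSmall p (p ^ k) j := by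
    intro j
    induction j with
    | zero => exact fun _ => cubeSumsSmall_zero k
    | succ j ih => exact fun hj => (ih (by omega)).succ hj
  exact this _ le_rfl

end CubeSums

/-! ### Restricting polynomials to combinatorial cubes -/

theorem prod_add_ite_mem_eq_sum_powerset {ι R : Type*} [DecidableEq ι] [CommSemiring R]
    (I X : Finset ι) (u v : ι → R) :
    ∏ i ∈ I, (u i + if i ∈ X then v i else 0) =
      ∑ A ∈ X.powerset, if A ⊆ I then (∏ i ∈ A, v i) * ∏ i ∈ I \ A, u i else 0 := by
  simp_rw [add_comm (u _)]
  rw [Finset.prod_add, ← Finset.sum_filter]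
  have h : ∀ A ∈ I.powerset, (∏ i ∈ A, if i ∈ X then v i else 0) * ∏ i ∈ I \ A, u i =
      if A ⊆ X then (∏ i ∈ A, v i) * ∏ i ∈ I \ A, u i else 0 := by
    intro A _
    rw [Finset.prod_ite_zero, ite_mul, zero_mul]
    rfl
  rw [Finset.sum_congr rfl h, ← Finset.sum_filter]
  refine Finset.sum_congr ?_ fun _ _ => rfl
  ext A
  simp only [Finset.mem_filter, Finset.mem_powerset]
  tauto

section Restriction

variable {p N : ℕ}

/-- The vertex of the cube `a + {0, 1}^N` given by the set `X`. -/
def cubePoint (a : Fin N → ZMod p) (X : Finset (Fin N)) : Fin N → ZMod p :=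
  fun i => a i + if i ∈ X then 1 else 0

/-- On {0,1} each power (a_i + x_i)^d is affine in x_i, so a monomial becomes multilinear in the
variables of its support, whose number is at most its degree. -/
theorem exists_cube_coeff_eval (g : MvPolynomial (Fin N) (ZMod p)) (a : Fin N → ZMod p) :
    ∃ c : Finset (Fin N) → ZMod p, (∀ A, g.totalDegree < A.card → c A = 0) ∧
      ∀ X, MvPolynomial.eval (cubePoint a X) g = ∑ A ∈ X.powerset, c A := by
  refine ⟨fun A => ∑ d ∈ g.support, g.coeff d * if A ⊆ d.support then
    (∏ i ∈ A, ((a i + 1) ^ d i - a i ^ d i)) * ∏ i ∈ d.support \ A, a i ^ d i else 0, ?_, ?_⟩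
  · intro A hA
    refine Finset.sum_eq_zero fun d hd => ?_
    rw [if_neg, mul_zero]
    intro hAd
    have h1 : A.card ≤ d.support.card := Finset.card_le_card hAd
    have h2 : d.support.card ≤ d.sum fun _ e => e := by
      rw [Finsupp.sum, Finset.card_eq_sum_ones]
      exact Finset.sum_le_sum fun i hi => Nat.one_le_iff_ne_zero.2 (Finsupp.mem_support_iff.1 hi)
    have h3 := MvPolynomial.le_totalDegree hd
    omega
  · intro X
    rw [MvPolynomial.eval_eq, Finset.sum_comm]
    refine Finset.sum_congr rfl fun d _ => ?_
    rw [← Finset.mul_sum, ← prod_add_ite_mem_eq_sum_powerset]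
    congr 1
    refine Finset.prod_congr rfl fun i _ => ?_
    by_cases hi : i ∈ X <;> simp [cubePoint, hi]

theorem symFun_eq_sum (n : ℕ) (x : Fin N → ZMod p) :
    symFun p N n x = ∑ I ∈ Finset.powersetCard n Finset.univ, ∏ i ∈ I, x i := by
  simp [symFun, MvPolynomial.esymm]

theorem exists_cube_coeff_symFun (n : ℕ) (a : Fin N → ZMod p) :
    ∃ c : Finset (Fin N) → ZMod p, (∀ A, A.card = n → c A = 1) ∧ (∀ A, n < A.card → c A = 0) ∧
      ∀ X, symFun p N n (cubePoint a X) = ∑ A ∈ X.powerset, c A := by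
  refine ⟨fun A => ∑ I ∈ Finset.powersetCard n Finset.univ, if A ⊆ I then
    (∏ i ∈ A, (1 : ZMod p)) * ∏ i ∈ I \ A, a i else 0, ?_, ?_, ?_⟩
  · intro A hA
    have hmem : A ∈ Finset.powersetCard n Finset.univ := by simp [hA]
    refine (Finset.sum_eq_single_of_mem A hmem fun I hI hne => if_neg fun hAI => hne ?_).trans ?_
    · exact (Finset.eq_of_subset_of_card_le hAI
        (by rw [(Finset.mem_powersetCard.1 hI).2, hA])).symm
    · simp
  · intro A hA
    refine Finset.sum_eq_zero fun I hI => if_neg fun hAI => ?_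
    have := Finset.card_le_card hAI
    rw [(Finset.mem_powersetCard.1 hI).2] at this
    omega
  · intro X
    rw [symFun_eq_sum, Finset.sum_comm]
    refine Finset.sum_congr rfl fun I _ => ?_
    rw [← prod_add_ite_mem_eq_sum_powerset]
    rfl

/-- An average over `𝔽_p^N` is an average of averages over cubes. -/
theorem two_pow_mul_expect [NeZero p] (φ : (Fin N → ZMod p) → ℂ) :
    2 ^ N * 𝔼 x, φ x =
      𝔼 a : Fin N → ZMod p, ∑ X ∈ (Finset.univ : Finset (Fin N)).powerset, φ (cubePoint a X) := by
  rw [Finset.expect_sum_comm]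
  have h : ∀ X ∈ (Finset.univ : Finset (Fin N)).powerset,
      𝔼 a : Fin N → ZMod p, φ (cubePoint a X) = 𝔼 x, φ x := fun X _ =>
    Fintype.expect_equiv (Equiv.addRight fun i => if i ∈ X then 1 else 0) _ _ fun _ => rfl
  rw [Finset.sum_congr rfl h]
  simp

/-- The symmetric polynomial `S_{p^k}` has negligible correlation with all polynomials of lower
degree. -/
theorem correlation_symFun_lt [Fact p.Prime] (k : ℕ) (δ : ℝ) (hδ : 0 < δ) :
    ∃ N₀ : ℕ, ∀ N : ℕ, N₀ ≤ N → ∀ g : MvPolynomial (Fin N) (ZMod p), g.totalDegree < p ^ k →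
      ‖correlation (symFun p N (p ^ k)) (fun x => MvPolynomial.eval x g)‖ < δ := by
  obtain ⟨N₀, hN₀⟩ := cubeSumsSmall (p := p) k (δ / 2) (half_pos hδ)
  refine ⟨N₀, fun N hN g hg => ?_⟩
  suffices h : ‖correlation (symFun p N (p ^ k)) (fun x => MvPolynomial.eval x g)‖ ≤ δ / 2 by
    linarith
  set φ : (Fin N → ZMod p) → ℂ := fun x =>
    ZMod.stdAddChar (symFun p N (p ^ k) x - MvPolynomial.eval x g) with hφ
  have hcube : ∀ a : Fin N → ZMod p,
      ‖∑ X ∈ (Finset.univ : Finset (Fin N)).powerset, φ (cubePoint a X)‖ ≤ δ / 2 * 2 ^ N := by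
    intro a
    obtain ⟨c₁, h1, h0, hc₁⟩ := exists_cube_coeff_symFun (p ^ k) a
    obtain ⟨c₂, h2, hc₂⟩ := exists_cube_coeff_eval g a
    have := hN₀ (Fin N) Finset.univ (by simpa using hN) (fun A => c₁ A - c₂ A)
      -- In degree p^k and above g contributes nothing, so only the leading coefficients of the
      -- symmetric polynomial remain.
      ⟨fun i => if i = p ^ k then 1 else 0, by simp, fun i hi => if_neg hi.ne', fun A _ hA => by
        dsimp only
        rw [h2 A (by omega), sub_zero]
        split_ifs with h
        · exact h1 A h
        · exact h0 A (by omega)⟩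
    simp only [Finset.sum_sub_distrib, ← hc₁, ← hc₂, Finset.card_univ, Fintype.card_fin] at this
    exact this
  have key : ‖(2 : ℂ) ^ N * 𝔼 x, φ x‖ ≤ δ / 2 * 2 ^ N := by
    rw [two_pow_mul_expect, Finset.expect_eq_sum_div_card, norm_div, Complex.norm_natCast,
      div_le_iff₀ (Nat.cast_pos.2 (Finset.card_pos.2 Finset.univ_nonempty)), mul_comm _ (Nat.cast _), ← nsmul_eq_mul,
      ← Finset.sum_const]
    exact norm_sum_le_of_le _ fun a _ => hcube a
  rw [norm_mul, norm_pow, Complex.norm_ofNat, mul_comm] at key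
  exact le_of_mul_le_mul_right key (by positivity)

end Restriction

/-! ### Sums over injective tuples -/

section Polar

variable {ι R : Type*} [DecidableEq ι] [CommRing R]

/-- The sum of `y 0 (i 0) * ⋯ * y (n - 1) (i (n - 1))` over tuples `i` of distinct elements of
`A`. -/
def polar : (n : ℕ) → (Fin n → ι → R) → Finset ι → R
  | 0, _, _ => 1
  | n + 1, y, A => ∑ i ∈ A, y 0 i * polar n (Fin.tail y) (A.erase i)

/-- The difference collects the tuples using the index i. They use it at exactly one position j,
where the weight z i is absorbed into y j. -/
theorem sum_mul_polar_sub_polar_erase (n : ℕ) (z : ι → R) (y : Fin n → ι → R) (A : Finset ι) :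
    ∑ i ∈ A, z i * (polar n y A - polar n y (A.erase i)) =
      ∑ j, polar n (Function.update y j (z * y j)) A := by
  induction n generalizing A with
  | zero => simp [polar]
  | succ n ih =>
    rw [Fin.sum_univ_succ]
    have h0 : polar (n + 1) (Function.update y 0 (z * y 0)) A =
        ∑ i ∈ A, z i * (y 0 i * polar n (Fin.tail y) (A.erase i)) := by
      simp only [polar, Fin.tail_update_zero, Function.update_self, Pi.mul_apply, mul_assoc]
    have h1 : ∀ j : Fin n, polar (n + 1) (Function.update y j.succ (z * y j.succ)) A =
        ∑ a ∈ A, y 0 a *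
          polar n (Function.update (Fin.tail y) j (z * Fin.tail y j)) (A.erase a) := by
      intro j
      simp only [polar, Fin.tail_update_succ]
      rfl
    rw [h0, Finset.sum_congr rfl fun j _ => h1 j, Finset.sum_comm]
    simp_rw [← Finset.mul_sum, ← ih]
    have h2 : ∀ i ∈ A, z i * (polar (n + 1) y A - polar (n + 1) y (A.erase i)) =
        z i * (y 0 i * polar n (Fin.tail y) (A.erase i)) +
          ∑ a ∈ A.erase i, y 0 a * (z i * (polar n (Fin.tail y) (A.erase a) -
            polar n (Fin.tail y) ((A.erase a).erase i))) := by
      intro i hi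
      simp only [polar]
      rw [← Finset.add_sum_erase _ _ hi, add_sub_assoc, ← Finset.sum_sub_distrib, mul_add,
        Finset.mul_sum]
      congr 1
      refine Finset.sum_congr rfl fun a _ => ?_
      rw [Finset.erase_right_comm]
      ring
    rw [Finset.sum_congr rfl h2, Finset.sum_add_distrib]
    congr 1
    simp_rw [Finset.mul_sum]
    refine Finset.sum_comm' fun i a => ?_
    simp only [Finset.mem_erase]
    tauto

/-- Let the first index run freely, then subtract its coincidences: meeting the j-th index merges y
0 into that vector. -/
theorem polar_succ_eq_sub (n : ℕ) (y : Fin (n + 1) → ι → R) (A : Finset ι) :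
    polar (n + 1) y A = (∑ i ∈ A, y 0 i) * polar n (Fin.tail y) A -
      ∑ j, polar n (Function.update (Fin.tail y) j (y 0 * Fin.tail y j)) A := by
  rw [← sum_mul_polar_sub_polar_erase, Finset.sum_mul, ← Finset.sum_sub_distrib, polar]
  exact Finset.sum_congr rfl fun i _ => by ring

/-- If all products over nonempty sets of vectors different from the last one have zero sum, then
only one term survives in the expansion of `polar` in terms of sums of products. -/
theorem polar_eq_factorial_mul [Fintype ι] (m : ℕ) (y : Fin (m + 1) → ι → R)
    (hy : ∀ B : Finset (Fin (m + 1)), B.Nonempty → Fin.last m ∉ B → ∑ i, ∏ j ∈ B, y j i = 0) :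
    polar (m + 1) y Finset.univ = (-1) ^ m * (m.factorial : R) * ∑ i, ∏ j, y j i := by
  induction m with
  | zero => simp [polar]
  | succ m ih =>
    have hprod : ∀ (j : Fin (m + 1)) (B : Finset (Fin (m + 1))) (i : ι), j ∈ B →
        ∏ l ∈ B, Function.update (Fin.tail y) j (y 0 * Fin.tail y j) l i =
          y 0 i * ∏ l ∈ B, Fin.tail y l i := by
      intro j B i hj
      rw [← Finset.mul_prod_erase _ _ hj, ← Finset.mul_prod_erase B (fun l => Fin.tail y l i) hj,
        Function.update_self, Pi.mul_apply, mul_assoc]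
      congr 2
      exact Finset.prod_congr rfl fun l hl => by
        rw [Function.update_of_ne (Finset.ne_of_mem_erase hl)]
    -- Merging y 0 into another vector preserves the hypothesis: products over B become products of
    -- the original vectors, with y 0 included exactly when j ∈ B. The full product is unchanged.
    have hstep : ∀ j : Fin (m + 1),
        polar (m + 1) (Function.update (Fin.tail y) j (y 0 * Fin.tail y j)) Finset.univ =
          (-1) ^ m * (m.factorial : R) * ∑ i, ∏ l, y l i := by
      intro j
      rw [ih]
      · congr 1
        refine Finset.sum_congr rfl fun i _ => ?_
        rw [hprod j _ i (Finset.mem_univ j), Fin.prod_univ_succ (fun l => y l i)]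
        rfl
      · intro B hB hlast
        have hmap : ∀ i, ∏ l ∈ B, Fin.tail y l i = ∏ l ∈ B.map (Fin.succEmb _), y l i := by
          intro i
          rw [Finset.prod_map]
          rfl
        have hl : Fin.last (m + 1) ∉ B.map (Fin.succEmb (m + 1)) := by
          rw [Finset.mem_map]
          rintro ⟨b, hb, hbl⟩
          have : b = Fin.last m := Fin.succ_injective _ hbl
          exact hlast (this ▸ hb)
        have h0 : (0 : Fin (m + 2)) ∉ B.map (Fin.succEmb (m + 1)) := by
          rw [Finset.mem_map]
          rintro ⟨b, -, hb⟩
          exact Fin.succ_ne_zero b hb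
        by_cases hj : j ∈ B
        · have := hy (insert 0 (B.map (Fin.succEmb (m + 1)))) (Finset.insert_nonempty _ _) (by
            rw [Finset.mem_insert, not_or]
            exact ⟨(Fin.last_pos).ne', hl⟩)
          rw [← this]
          refine Finset.sum_congr rfl fun i _ => ?_
          rw [hprod j B i hj, Finset.prod_insert h0, hmap]
        · have := hy (B.map (Fin.succEmb (m + 1))) (hB.map) hl
          rw [← this]
          refine Finset.sum_congr rfl fun i _ => ?_
          rw [← hmap]
          refine Finset.prod_congr rfl fun l hl => ?_
          have hne : l ≠ j := fun h => hj (h ▸ hl)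
          rw [Function.update_of_ne hne]
    have hz : ∑ i, y 0 i = 0 := by
      have := hy {0} (Finset.singleton_nonempty 0) (by
        rw [Finset.mem_singleton]; exact (Fin.last_pos).ne')
      simpa using this
    -- The m + 1 equal merged terms turn m! into (m + 1)!, and the subtraction supplies the sign.
    rw [polar_succ_eq_sub, hz, zero_mul, Finset.sum_congr rfl fun j _ => hstep j,
      Finset.sum_const, Finset.card_univ, Fintype.card_fin, Nat.factorial_succ, nsmul_eq_mul]
    push_cast
    ring

end Polar

/-! ### Iterated derivatives of elementary symmetric polynomials -/

section Derivative

/-- The definition peels off the last direction; induction on the degree of f needs the first. -/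
theorem iterDeriv_succ_eq_tail {V F : Type*} [AddCommGroup V] [AddCommGroup F] (f : V → F) (k : ℕ)
    (y : Fin (k + 1) → V) :
    iterDeriv f (k + 1) y = iterDeriv (fwdDiff (y 0) f) k (Fin.tail y) := by
  induction k with
  | zero => rfl
  | succ k ih =>
    rw [iterDeriv, ih, Fin.tail_init_eq_init_tail, iterDeriv]
    rfl

theorem iterDeriv_add {V F : Type*} [AddCommGroup V] [AddCommGroup F] (f g : V → F) (k : ℕ)
    (y : Fin k → V) : iterDeriv (f + g) k y = iterDeriv f k y + iterDeriv g k y := by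
  induction k with
  | zero => rfl
  | succ k ih => rw [iterDeriv, ih, fwdDiff_add]; rfl

theorem iterDeriv_sum_smul {V F α : Type*} [AddCommGroup V] [Ring F] (s : Finset α) (c : α → F)
    (f : α → V → F) (k : ℕ) (y : Fin k → V) :
    iterDeriv (∑ a ∈ s, c a • f a) k y = ∑ a ∈ s, c a • iterDeriv (f a) k y := by
  induction k with
  | zero => rfl
  | succ k ih =>
    rw [iterDeriv, ih, fwdDiff_finsetSum]
    exact Finset.sum_congr rfl fun a _ => fwdDiff_const_smul _ _ _

variable {ι R : Type*} [CommRing R]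

variable (ι R) in
/-- The functions spanned by squarefree monomials of degree less than `r`. -/
def multilinearLT (r : ℕ) : Submodule R ((ι → R) → R) :=
  Submodule.span R {f | ∃ I : Finset ι, I.card < r ∧ f = fun x => ∏ i ∈ I, x i}

theorem sum_smul_prod_mem_multilinearLT {α : Type*} {r : ℕ} (s : Finset α) (c : α → R)
    (I : α → Finset ι) (hI : ∀ a ∈ s, (I a).card < r) :
    (fun x : ι → R => ∑ a ∈ s, c a * ∏ i ∈ I a, x i) ∈ multilinearLT ι R r := by
  have : (fun x : ι → R => ∑ a ∈ s, c a * ∏ i ∈ I a, x i) =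
      ∑ a ∈ s, c a • fun x : ι → R => ∏ i ∈ I a, x i := by
    ext x
    simp
  rw [this]
  exact Submodule.sum_mem _ fun a ha => Submodule.smul_mem _ _
    (Submodule.subset_span ⟨I a, hI a ha, rfl⟩)

variable [DecidableEq ι]

theorem fwdDiff_mem_multilinearLT {r : ℕ} {f : (ι → R) → R} (hf : f ∈ multilinearLT ι R (r + 1))
    (y : ι → R) : fwdDiff y f ∈ multilinearLT ι R r := by
  induction hf using Submodule.span_induction with
  | mem f hf =>
    obtain ⟨I, hI, rfl⟩ := hf
    have : fwdDiff y (fun x : ι → R => ∏ i ∈ I, x i) =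
        fun x => ∑ J ∈ I.powerset.erase I, (∏ i ∈ I \ J, y i) * ∏ i ∈ J, x i := by
      ext x
      simp only [fwdDiff, Pi.add_apply]
      rw [Finset.prod_add, ← Finset.add_sum_erase _ _ (Finset.mem_powerset_self I)]
      simp [mul_comm]
    rw [this]
    refine sum_smul_prod_mem_multilinearLT _ _ _ fun J hJ => ?_
    rw [Finset.mem_erase, Finset.mem_powerset] at hJ
    have := Finset.card_lt_card (Finset.ssubset_iff_subset_ne.2 ⟨hJ.2, hJ.1⟩)
    omega
  | zero =>
    have : fwdDiff y (0 : (ι → R) → R) = 0 := by ext x; simp [fwdDiff]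
    rw [this]
    exact Submodule.zero_mem _
  | add f g _ _ hf hg => rw [fwdDiff_add]; exact Submodule.add_mem _ hf hg
  | smul c f _ hf => rw [fwdDiff_const_smul]; exact Submodule.smul_mem _ _ hf

theorem iterDeriv_eq_zero_of_mem_multilinearLT {r : ℕ} {f : (ι → R) → R}
    (hf : f ∈ multilinearLT ι R r) (y : Fin r → ι → R) : iterDeriv f r y = 0 := by
  induction r generalizing f with
  | zero => simpa [multilinearLT, iterDeriv] using hf
  | succ r ih =>
    rw [iterDeriv_succ_eq_tail]
    exact ih (fwdDiff_mem_multilinearLT hf _) _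

/-- The elementary symmetric function of degree `r` in the variables indexed by `A`. -/
def esymmOn (A : Finset ι) (r : ℕ) (x : ι → R) : R :=
  ∑ I ∈ Finset.powersetCard r A, ∏ i ∈ I, x i

theorem sum_powersetCard_succ_sum_erase {M : Type*} [AddCommMonoid M] (A : Finset ι) (r : ℕ)
    (F : ι → Finset ι → M) :
    ∑ I ∈ Finset.powersetCard (r + 1) A, ∑ i ∈ I, F i (I.erase i) =
      ∑ i ∈ A, ∑ I ∈ Finset.powersetCard r (A.erase i), F i I := by
  rw [Finset.sum_sigma', Finset.sum_sigma']
  refine Finset.sum_nbij' (fun q => ⟨q.2, q.1.erase q.2⟩) (fun q => ⟨insert q.1 q.2, q.1⟩)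
    ?_ ?_ ?_ ?_ ?_
  · rintro ⟨I, i⟩ h
    simp only [Finset.mem_sigma, Finset.mem_powersetCard] at h ⊢
    exact ⟨h.1.1 h.2, Finset.erase_subset_erase _ h.1.1,
      by rw [Finset.card_erase_of_mem h.2, h.1.2]; rfl⟩
  · rintro ⟨i, I⟩ h
    simp only [Finset.mem_sigma, Finset.mem_powersetCard] at h ⊢
    have hi : i ∉ I := fun hi => by simpa using h.2.1 hi
    exact ⟨⟨Finset.insert_subset h.1 (h.2.1.trans (Finset.erase_subset _ _)),
      by rw [Finset.card_insert_of_notMem hi, h.2.2]⟩, Finset.mem_insert_self _ _⟩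
  · rintro ⟨I, i⟩ h
    simp only [Finset.mem_sigma] at h
    simp [Finset.insert_erase h.2]
  · rintro ⟨i, I⟩ h
    simp only [Finset.mem_sigma, Finset.mem_powersetCard] at h
    have hi : i ∉ I := fun hi => by simpa using h.2.1 hi
    simp [Finset.erase_insert hi]
  · rintro ⟨I, i⟩ _
    rfl

/-- Expand ∏ (x_i + y_i) by the set J of factors contributing y: J = ∅ cancels, |J| = 1 is the main
term, and |J| ≥ 2 leaves degree below r. In the witness |J| = j + 2. -/
theorem exists_fwdDiff_esymmOn (A : Finset ι) (r : ℕ) (y : ι → R) :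
    ∃ g ∈ multilinearLT ι R r,
      fwdDiff y (esymmOn A (r + 1)) = (∑ i ∈ A, y i • esymmOn (A.erase i) r) + g := by
  refine ⟨∑ I ∈ Finset.powersetCard (r + 1) A, ∑ j ∈ Finset.range r,
    fun x => ∑ J ∈ Finset.powersetCard (j + 2) I, (∏ i ∈ J, y i) * ∏ i ∈ I \ J, x i, ?_, ?_⟩
  · refine Submodule.sum_mem _ fun I hI => Submodule.sum_mem _ fun j hj =>
      sum_smul_prod_mem_multilinearLT _ _ _ fun J hJ => ?_
    rw [Finset.mem_powersetCard] at hI hJ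
    have := Finset.card_sdiff_add_card_eq_card hJ.1
    omega
  · ext x
    have hsymm : (∑ i ∈ A, y i • esymmOn (A.erase i) r : (ι → R) → R) x =
        ∑ I ∈ Finset.powersetCard (r + 1) A, ∑ i ∈ I, y i * ∏ l ∈ I.erase i, x l := by
      rw [sum_powersetCard_succ_sum_erase A r fun i I => y i * ∏ l ∈ I, x l]
      simp [esymmOn, Finset.mul_sum]
    rw [Pi.add_apply, hsymm, Finset.sum_apply, ← Finset.sum_add_distrib]
    simp only [fwdDiff, esymmOn, Pi.add_apply]
    rw [← Finset.sum_sub_distrib]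
    refine Finset.sum_congr rfl fun I hI => ?_
    rw [Finset.mem_powersetCard] at hI
    simp_rw [add_comm (x _)]
    rw [Finset.prod_add, Finset.sum_powerset, hI.2, Finset.sum_range_succ', Finset.sum_range_succ',
      Finset.powersetCard_zero, Finset.powersetCard_one, Finset.sum_map, Finset.sum_apply]
    simp only [Function.Embedding.coeFn_mk, Finset.sum_singleton, Finset.prod_singleton,
      Finset.prod_empty, Finset.sdiff_singleton_eq_erase, Finset.sdiff_empty, one_mul,
      add_sub_cancel_right]
    exact add_comm _ _

/-- The error terms of degree below r die under the r remaining derivatives, and the main terms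
follow the recursion of `polar`. -/
theorem iterDeriv_esymmOn (A : Finset ι) (r : ℕ) (y : Fin r → ι → R) (x : ι → R) :
    iterDeriv (esymmOn A r) r y x = polar r y A := by
  induction r generalizing A with
  | zero => simp [iterDeriv, esymmOn, polar]
  | succ r ih =>
    obtain ⟨g, hg, h⟩ := exists_fwdDiff_esymmOn A r (y 0)
    rw [iterDeriv_succ_eq_tail, h, iterDeriv_add, iterDeriv_sum_smul,
      iterDeriv_eq_zero_of_mem_multilinearLT hg, add_zero, Finset.sum_apply, polar]
    exact Finset.sum_congr rfl fun i _ => by rw [Pi.smul_apply, ih, smul_eq_mul]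

end Derivative

/-! ### The Gowers norm of symmetric polynomials -/

theorem prod_finset_fin_succ {M : Type*} [CommMonoid M] {m : ℕ} (B : Finset (Fin (m + 1)))
    (f : Fin (m + 1) → M) :
    ∏ j ∈ B, f j = (∏ j : Fin m with j.castSucc ∈ B, f j.castSucc) *
      if Fin.last m ∈ B then f (Fin.last m) else 1 := by
  rw [← Finset.univ_inter B, ← Finset.prod_ite_mem, Fin.prod_univ_castSucc, Finset.prod_filter]
  simp

section Norm

variable {p N : ℕ}

/-- All products over nonempty subfamilies of `y` have zero sum. -/
def IsNull {m : ℕ} (y : Fin m → Fin N → ZMod p) : Prop :=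
  ∀ B : Finset (Fin m), B.Nonempty → ∑ i, ∏ j ∈ B, y j i = 0

theorem IsNull.sum_prod_snoc {m : ℕ} {y : Fin m → Fin N → ZMod p} (hy : IsNull y)
    (z : Fin N → ZMod p) (B : Finset (Fin (m + 1))) (hB : B.Nonempty) (hl : Fin.last m ∉ B) :
    ∑ i, ∏ j ∈ B, (Fin.snoc y z : Fin (m + 1) → Fin N → ZMod p) j i = 0 := by
  simp only [prod_finset_fin_succ, if_neg hl, Fin.snoc_castSucc, mul_one]
  refine hy _ ?_
  obtain ⟨b, hb⟩ := hB
  have hne : b ≠ Fin.last m := fun h => hl (h ▸ hb)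
  exact ⟨b.castPred hne, by simpa using hb⟩

theorem IsNull.snoc {m : ℕ} {y : Fin m → Fin N → ZMod p} (hy : IsNull y) {z : Fin N → ZMod p}
    (hz : ∀ B : Finset (Fin m), ∑ i, z i * ∏ j ∈ B, y j i = 0) :
    IsNull (Fin.snoc y z : Fin (m + 1) → Fin N → ZMod p) := by
  intro B hB
  by_cases hl : Fin.last m ∈ B
  · simp only [prod_finset_fin_succ, if_pos hl, Fin.snoc_castSucc, Fin.snoc_last]
    simp_rw [mul_comm _ (z _)]
    exact hz _
  · exact hy.sum_prod_snoc z B hB hl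

/-- The linear conditions on `z` that keep a family `y` null when `z` is appended. -/
def nullConditions {m : ℕ} (y : Fin m → Fin N → ZMod p) :
    (Fin N → ZMod p) →+ (Finset (Fin m) → ZMod p) where
  toFun z B := ∑ i, z i * ∏ j ∈ B, y j i
  map_zero' := by ext; simp
  map_add' z w := by ext; simp [add_mul, Finset.sum_add_distrib]

theorem card_le_card_mul_card_ker {G H : Type*} [AddGroup G] [AddGroup H] [Finite H] (f : G →+ H) :
    Nat.card G ≤ Nat.card H * Nat.card f.ker := by
  rw [← f.ker.index_mul_card, AddSubgroup.index_ker]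
  exact Nat.mul_le_mul_right _ (Nat.card_le_card_of_injective _ Subtype.val_injective)

theorem symFun_eq_esymmOn (n : ℕ) : symFun p N n = esymmOn Finset.univ n :=
  funext fun x => symFun_eq_sum n x

variable [Fact p.Prime]

/-- Vectors are appended one at a time. The m-th step imposes 2^m linear conditions, so its kernel
has density at least p^(-2^m), and 2^m + 2^m = 2^(m+1). -/
theorem pow_le_mul_card_isNull (m : ℕ) :
    (p ^ N) ^ m ≤ p ^ 2 ^ m * Nat.card {y : Fin m → Fin N → ZMod p // IsNull y} := by
  induction m with
  | zero =>
    have : Nat.card {y : Fin 0 → Fin N → ZMod p // IsNull y} ≠ 0 := by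
      have : Nonempty {y : Fin 0 → Fin N → ZMod p // IsNull y} :=
        ⟨⟨Fin.elim0, fun B hB => hB.elim fun b _ => b.elim0⟩⟩
      exact Nat.card_ne_zero.2 ⟨this, inferInstance⟩
    have hp : 0 < p := (Fact.out : p.Prime).pos
    simp only [pow_zero, pow_one]
    exact Nat.mul_pos hp (Nat.pos_of_ne_zero this)
  | succ m ih =>
    classical
    have hinj : Nat.card (Σ y : {y : Fin m → Fin N → ZMod p // IsNull y}, (nullConditions y.1).ker) ≤
        Nat.card {y : Fin (m + 1) → Fin N → ZMod p // IsNull y} := by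
      refine Nat.card_le_card_of_injective (fun q => ⟨Fin.snoc q.1.1 q.2.1, q.1.2.snoc fun B =>
        congrFun (AddMonoidHom.mem_ker.1 q.2.2) B⟩) ?_
      rintro ⟨⟨y, hy⟩, ⟨z, hz⟩⟩ ⟨⟨y', hy'⟩, ⟨z', hz'⟩⟩ h
      obtain ⟨rfl, rfl⟩ := Fin.snoc_injective2 (Subtype.mk.inj h)
      rfl
    have hker : ∀ y : {y : Fin m → Fin N → ZMod p // IsNull y},
        p ^ N ≤ p ^ 2 ^ m * Nat.card (nullConditions y.1).ker := by
      intro y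
      have := card_le_card_mul_card_ker (nullConditions y.1)
      simpa [Nat.card_eq_fintype_card] using this
    calc (p ^ N) ^ (m + 1) = (p ^ N) ^ m * p ^ N := pow_succ _ _
      _ ≤ p ^ 2 ^ m * Nat.card {y : Fin m → Fin N → ZMod p // IsNull y} * p ^ N := by gcongr
      _ = p ^ 2 ^ m * ∑ _y : {y : Fin m → Fin N → ZMod p // IsNull y}, p ^ N := by
          rw [Finset.sum_const, Finset.card_univ, Nat.card_eq_fintype_card, smul_eq_mul, mul_assoc]
      _ ≤ p ^ 2 ^ m * ∑ y : {y : Fin m → Fin N → ZMod p // IsNull y},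
            p ^ 2 ^ m * Nat.card (nullConditions y.1).ker := by
          gcongr with y
          exact hker y
      _ = p ^ 2 ^ (m + 1) *
            Nat.card (Σ y : {y : Fin m → Fin N → ZMod p // IsNull y}, (nullConditions y.1).ker) := by
          rw [Nat.card_sigma, ← Finset.mul_sum, pow_succ 2 m, mul_two, pow_add, mul_assoc]
      _ ≤ _ := by gcongr

/-- The difference of the two sides is a derivative at 0 in the extra direction x, hence a multiple
of m!, which vanishes mod p. The vector x need not be null, since it comes last. -/
theorem IsNull.iterDeriv_symFun_eq {m : ℕ} (hm : p ≤ m) {y : Fin m → Fin N → ZMod p}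
    (hy : IsNull y) (x : Fin N → ZMod p) :
    iterDeriv (symFun p N (m + 1)) m y x = iterDeriv (symFun p N (m + 1)) m y 0 := by
  have h := iterDeriv_esymmOn Finset.univ (m + 1)
    (Fin.snoc y x : Fin (m + 1) → Fin N → ZMod p) 0
  rw [polar_eq_factorial_mul m _ (hy.sum_prod_snoc x),
    (ZMod.natCast_eq_zero_iff _ _).2 ((Fact.out : p.Prime).dvd_factorial.2 hm), mul_zero, zero_mul,
    ← symFun_eq_esymmOn, iterDeriv, Fin.init_snoc, Fin.snoc_last, fwdDiff, zero_add,
    sub_eq_zero] at h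
  exact h

theorem inv_le_norm_gowersAverage_symFun {m : ℕ} (hm : p ≤ m) (N : ℕ) :
    ((p : ℝ) ^ 2 ^ m)⁻¹ ≤ ‖gowersAverage (m + 1) (symFun p N (m + 1))‖ := by
  classical
  have hp : (0 : ℝ) < p := Nat.cast_pos.2 (Fact.out : p.Prime).pos
  rw [gowersAverage_succ, Complex.norm_of_nonneg (Finset.expect_nonneg fun _ _ => sq_nonneg _)]
  have hle : 𝔼 y : Fin m → Fin N → ZMod p, (if IsNull y then (1 : ℝ) else 0) ≤
      𝔼 y : Fin m → Fin N → ZMod p, ‖𝔼 x : Fin N → ZMod p,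
        (ZMod.stdAddChar (iterDeriv (symFun p N (m + 1)) m y x) : ℂ)‖ ^ 2 := by
    refine Finset.expect_le_expect fun y _ => ?_
    split_ifs with hy
    · simp_rw [hy.iterDeriv_symFun_eq hm]
      rw [Finset.expect_const Finset.univ_nonempty, AddChar.norm_apply, one_pow]
    · positivity
  refine le_trans ?_ hle
  have hcount : ((p : ℝ) ^ N) ^ m ≤
      (p : ℝ) ^ 2 ^ m * Nat.card {y : Fin m → Fin N → ZMod p // IsNull y} := by
    exact_mod_cast pow_le_mul_card_isNull m
  rw [Finset.expect_eq_sum_div_card, Finset.sum_boole, ← Fintype.card_subtype,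
    ← Nat.card_eq_fintype_card, Finset.card_univ, le_div_iff₀ (Nat.cast_pos.2 Fintype.card_pos),
    inv_mul_le_iff₀ (by positivity)]
  simpa using hcount

theorem exists_lt_gowersNorm_symFun (n : ℕ) (hn : p < n) :
    ∃ ε : ℝ, 0 < ε ∧ ∀ N : ℕ, ε < gowersNorm n (symFun p N n) := by
  obtain ⟨m, rfl⟩ : ∃ m, n = m + 1 := ⟨n - 1, by omega⟩
  have hp : (0 : ℝ) < p := Nat.cast_pos.2 (Fact.out : p.Prime).pos
  set ε : ℝ := ((p : ℝ) ^ 2 ^ m)⁻¹ ^ (1 / (2 : ℝ) ^ (m + 1)) with hε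
  have hε0 : 0 < ε := Real.rpow_pos_of_pos (by positivity) _
  -- Halving turns the non-strict bound into a strict one.
  refine ⟨ε / 2, half_pos hε0, fun N => (half_lt_self hε0).trans_le ?_⟩
  exact Real.rpow_le_rpow (by positivity)
    (inv_le_norm_gowersAverage_symFun (by omega) N) (by positivity)

end Norm

end GowersInverse

end

open GowersInverse in
theorem mainTheorem3 (p : ℕ) [Fact p.Prime] (k : ℕ) (hk : 2 ≤ k) :
    (∃ ε : ℝ, 0 < ε ∧ ∀ N : ℕ, ε < gowersNorm (p ^ k) (symFun p N (p ^ k))) ∧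
    (∀ δ : ℝ, 0 < δ → ∃ N₀ : ℕ, ∀ N : ℕ, N₀ ≤ N →
      ∀ g : MvPolynomial (Fin N) (ZMod p), g.totalDegree < p ^ k →
        ‖correlation (symFun p N (p ^ k)) (fun x => MvPolynomial.eval x g)‖ < δ) ∧
    ¬ InverseConjecture p (p ^ k) := by
  have hp : p.Prime := Fact.out
  -- This is where k ≥ 2 enters: for k = 1 the factor (p - 1)! is nonzero mod p.
  have hlt : p < p ^ k := by
    calc p = p ^ 1 := (pow_one p).symm
      _ < p ^ k := Nat.pow_lt_pow_right hp.one_lt hk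
  have h1 := exists_lt_gowersNorm_symFun (p := p) (p ^ k) hlt
  have h2 := correlation_symFun_lt (p := p) k
  refine ⟨h1, h2, fun hinv => ?_⟩
  obtain ⟨ε, hε, hnorm⟩ := h1
  obtain ⟨δ, hδ, N₁, hN₁⟩ := hinv ε hε
  obtain ⟨N₂, hN₂⟩ := h2 δ hδ
  obtain ⟨g, hg, hcorr⟩ := hN₁ (max N₁ N₂) (le_max_left _ _) _ (hnorm _)
  exact lt_asymm hcorr (hN₂ _ (le_max_right _ _) g hg)
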